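/- **Setting.** Let $\Gamma'$ be a group, $\Gamma\subset\Gamma'$ a subgroup, and $n\ge 0$. All chains are ordered simplicial chains with coefficients in $\mathbb Z$ and all homology is reduced (so a $0$-cycle has total mass $0$); a simplicial complex is *(homologically) $n$-connected* if it is nonempty and its reduced homology vanishes in degrees $\le n$. An *$n$-connected thickening* of a group is an $n$-connected simplicial complex on which the group acts simplicially, with finite vertex stabilizers and finitely many orbits of simplices. Let $X'$ be an $n$-connected thickening of $\Gamma'$ and let $X\subset X'$ be a $\Gamma$-invariant subcomplex which is an $n$-connected thickening of $\Gamma$. Each of $X,X'$ carries its edge-path metric $d_X$, $d_{X'}$ on vertices (quasi-isometric to the word metrics of $\Gamma$, $\Gamma'$); the metric $dist_{\Gamma'}|\Gamma$ is represented by $d_{X'}$ restricted to the vertices of $X$. For an $n$-cycle $S$ of a complex $Y$, $FillRad_n(S,Y)$ is the least integer $R\ge 0$ such that $S$ is the boundary of an $(n+1)$-chain in $U_R(S)\subset Y$, the full subcomplex on the vertices at $d_Y$-distance $\le R$ from the vertices of $S$ ($\infty$ if there is none). Fix any class $\mathcal S$ of $n$-cycles of $X$. For $m\in\mathbb N$ put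 $$Disto(FillRad_n,\Gamma',\Gamma,m)=\sup\{FillRad_n(S,X): S\in\mathcal S,\ FillRad_n(S,X')\le m\}.$$ Fix a vertex $o$ of $X$, and let $B(r)$ be the full subcomplex of $X$ on the vertices $v$ of $X$ with $d_{X'}(o,v)\le r$. For $k\ge 0$ let $\overline{R_k}(r)$ be the infimal integer $R\ge r$ such that the inclusion $B(r)\subset B(R)$ is $k$-connected, i.e. induces the zero map on reduced homology in degrees $0,\dots,k$ ($\infty$ if there is none). **Proposition.** Let $k\ge n$. 1. If $Disto(FillRad_n,\Gamma',\Gamma,m)$ is superexponential in $m$, i.e. for every real $C$ one has $Disto(FillRad_n,\Gamma',\Gamma,m)>e^{Cm}$ for arbitrarily large $m$, then $\overline{R_k}(m)$ for $(\Gamma,dist_{\Gamma'}|\Gamma)$ is not bounded by any linear function: for every real $C$ one has $\overline{R_k}(m)>Cm$ for arbitrarily large $m$. 2. Suppose in addition that the cycles of $\mathcal S$ have diameter at most linear in their filling radius, i.e. there is $L\in\mathbb{N}$ such that $d_{X'}(v,w)\le L\,(FillRad_n(S,X')+1)$ for all $S\in\mathcal S$ and all vertices $v,w$ of $S$ (this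 holds for instance for $n=0$ and the class of copies $b-a$ of $S^0$). If for every real $C$ one has $Disto(FillRad_n,\Gamma',\Gamma,m)>e^{Cm}$ for all sufficiently large $m$, then for every real $C$ one has $\overline{R_k}(m)>Cm$ for all sufficiently large $m$. -/

import Mathlib

open Filter
open scoped ENNReal

noncomputable section

namespace FillingDistortion

/-- Ordered integral simplicial chains on the vertex set `V`, spanned by `j`-tuples of vertices;
an `n`-chain is an element of `Chain V (n + 1)`. -/
abbrev Chain (V : Type*) (j : ℕ) : Type _ := (Fin j → V) →₀ ℤ

/-- The boundary `∂(x₀, …, x_j) = ∑ i, (-1)^i (x₀, …, x̂ᵢ, …, x_j)`. On `0`-chains (`j = 0`) it is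
the augmentation, so that all homology below is reduced. -/
def bdry {V : Type*} (j : ℕ) : Chain V (j + 1) →ₗ[ℤ] Chain V j :=
  Finsupp.linearCombination ℤ fun x : Fin (j + 1) → V =>
    ∑ i : Fin (j + 1), Finsupp.single (x ∘ i.succAbove) ((-1 : ℤ) ^ (i : ℕ))

/-- The vertices that occur in a chain with nonzero coefficient. -/
def vertexSupport {V : Type*} {j : ℕ} (c : Chain V j) : Set V :=
  {v | ∃ x ∈ c.support, v ∈ Set.range x}

open Classical in
/-- The chain `c` lies in the complex `K`: the vertices of each of its tuples span a simplex
of `K`. -/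
def IsChainIn {V : Type*} (K : PreAbstractSimplicialComplex V) {j : ℕ} (c : Chain V j) : Prop :=
  ∀ x ∈ c.support, Finset.univ.image x ∈ K

/-- `S` is a simplicial `n`-cycle of `K` (for `n = 0`, of total mass zero). -/
def IsCycleIn {V : Type*} (K : PreAbstractSimplicialComplex V) {n : ℕ}
    (S : Chain V (n + 1)) : Prop :=
  IsChainIn K S ∧ bdry n S = 0

/-- `S` is the boundary of an `(n + 1)`-chain of `K`. -/
def BoundsIn {V : Type*} (K : PreAbstractSimplicialComplex V) {n : ℕ}
    (S : Chain V (n + 1)) : Prop :=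
  ∃ c : Chain V (n + 2), IsChainIn K c ∧ bdry (n + 1) c = S

/-- The inclusion `A ⊆ B` induces the zero map on reduced homology in all degrees `≤ k`. -/
def IsConnectedInclusion {V : Type*} (k : ℕ) (A B : PreAbstractSimplicialComplex V) : Prop :=
  ∀ i ≤ k, ∀ S : Chain V (i + 1), IsCycleIn A S → BoundsIn B S

/-- `K` is homologically `n`-connected: it is nonempty and its reduced integral homology vanishes
in all degrees `≤ n`. -/
def IsHomologicallyConnected {V : Type*} (n : ℕ) (K : PreAbstractSimplicialComplex V) : Prop :=
  (∃ s, s ∈ K) ∧ IsConnectedInclusion n K K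

/-- The full subcomplex of `K` spanned by the vertices of `K` that lie in `A`. -/
def fullSubcomplex {V : Type*} (K : PreAbstractSimplicialComplex V) (A : Set V) :
    PreAbstractSimplicialComplex V where
  faces := {s | s ∈ K ∧ ∀ v ∈ s, v ∈ A}
  isRelLowerSet_faces := fun _ hs =>
    ⟨(K.isRelLowerSet_faces hs.1).1, fun _ hts ht =>
      ⟨(K.isRelLowerSet_faces hs.1).2 hts ht, fun v hv => hs.2 v (hts hv)⟩⟩

open Classical in
/-- The `1`-skeleton of `K`. -/
def edgeGraph {V : Type*} (K : PreAbstractSimplicialComplex V) : SimpleGraph V where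
  Adj v w := v ≠ w ∧ ({v, w} : Finset V) ∈ K
  symm := ⟨fun v w h => ⟨h.1.symm, by rw [Finset.pair_comm]; exact h.2⟩⟩
  loopless := ⟨fun _ h => h.1 rfl⟩

/-- The path metric of `K` on vertices: the length of a shortest edge path (`⊤` if none). -/
def pathDist {V : Type*} (K : PreAbstractSimplicialComplex V) (v w : V) : ℕ∞ :=
  (edgeGraph K).edist v w

/-- The `R`-neighbourhood `U_R(S)` in `K` of the support of `S`, for the path metric of `K`. -/
def nbhd {V : Type*} (K : PreAbstractSimplicialComplex V) {j : ℕ} (S : Chain V j) (R : ℕ) :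
    PreAbstractSimplicialComplex V :=
  fullSubcomplex K {v | ∃ w ∈ vertexSupport S, pathDist K w v ≤ R}

/-- `FillRad_n(S, K)`: the least `R` such that `S` bounds in `U_R(S) ⊆ K` (`⊤` if none). -/
def fillRad {V : Type*} (K : PreAbstractSimplicialComplex V) {n : ℕ}
    (S : Chain V (n + 1)) : ℕ∞ :=
  ⨅ (R : ℕ) (_ : BoundsIn (nbhd K S R) S), (R : ℕ∞)

/-- `Disto(FillRad_n, K', K, m)` for a class `𝒮` of `n`-cycles of `K ⊆ K'`: the supremum of
`FillRad_n(S, K)` over the `S ∈ 𝒮` with `FillRad_n(S, K') ≤ m`. -/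
def disto {V : Type*} {n : ℕ} (K' K : PreAbstractSimplicialComplex V)
    (𝒮 : Set (Chain V (n + 1))) (m : ℕ) : ℕ∞ :=
  ⨆ (S : Chain V (n + 1)) (_ : S ∈ 𝒮 ∧ fillRad K' S ≤ m), fillRad K S

/-- The ball `B(r)` around `o` in `K`, for the metric restricted from the ambient `K'`. -/
def ball {V : Type*} (K' K : PreAbstractSimplicialComplex V) (o : V) (r : ℕ) :
    PreAbstractSimplicialComplex V :=
  fullSubcomplex K {v | pathDist K' o v ≤ r}

/-- The function `R̄_k(r)` of `K` with the metric restricted from `K'`: the infimal `R ≥ r` such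
that the inclusion `B(r) ⊆ B(R)` is `k`-connected (`⊤` if there is none). -/
def ballConnectivity {V : Type*} (k : ℕ) (K' K : PreAbstractSimplicialComplex V) (o : V)
    (r : ℕ) : ℕ∞ :=
  ⨅ (R : ℕ) (_ : r ≤ R ∧ IsConnectedInclusion k (ball K' K o r) (ball K' K o R)), (R : ℕ∞)

/-- `K` is an `n`-connected thickening of the group `G` acting on the vertex set `V`: `G` acts on
`K` simplicially, properly (finite vertex stabilizers) and cocompactly (finitely many orbits of
simplices), and `K` is homologically `n`-connected. -/
structure IsThickening (G : Type*) {V : Type*} [Group G] [MulAction G V] (n : ℕ)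
    (K : PreAbstractSimplicialComplex V) : Prop where
  invariant : ∀ (g : G), ∀ s ∈ K, s.map (MulAction.toPerm g).toEmbedding ∈ K
  proper : ∀ v : V, {v} ∈ K → Finite (MulAction.stabilizer G v)
  cocompact : ∃ F : Set (Finset V), F.Finite ∧
    ∀ s ∈ K, ∃ g : G, ∃ t ∈ F, s = t.map (MulAction.toPerm g).toEmbedding
  connected : IsHomologicallyConnected n K

end FillingDistortion

end

/-!
The contrapositive of each part is proved: if the inclusions `B(r) ⊆ B(R)` are `k`-connected with
`R` linear in `r`, then the distortion is at most exponential.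

The exponential comes from counting. By uniform local finiteness of `K'` the ball `B(R)` has at
most `M ^ R` vertices, so two vertices in one component of `B(R)` are at `K`-distance at most
`M ^ R`. A filling of a cycle inside `B(R)` may be restricted to the components that meet the
cycle (`BoundsIn.exists_reachable`), and then it stays at `K`-distance at most `M ^ R` from the
cycle. Since the subgroup acts cocompactly on `K`, the same holds around every vertex of `K`, up to
a bounded change of the radii (`exists_hasLocalFillings`).

When the cycles have diameter at most `L (m + 1)`, this applied to the cycle itself, at one scale
`r` comparable with `m`, bounds the distortion at `m` (`eventually_exists_disto_le_exp`).

Without a bound on the diameter, take a cycle `S` of `K` that is the boundary of a chain `c` in its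
`m`-neighbourhood in `K'`. Moving each vertex of `c` to a vertex of `S` at distance at most `m`
fixes `S` and turns `c` into a chain of the Rips complex of `K` with parameter `2m + 1`, for the
restricted metric. Local fillings define, by induction on the degree, a chain map from this Rips
complex to `K` that is the identity on `K` and moves supports by at most a linear amount in `K'` and
an exponential amount in `K` (`IsControlled.exists_extension`, `exists_isControlled`). The image of
the Rips chain is a filling of `S` in `K` at `K`-distance at most exponential in `m` from `S`
(`exists_boundsIn_nbhd`), which gives `eventually_disto_le_exp`.
-/

namespace FillingDistortion

/-! ### Chains and chain maps -/

section Chains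

variable {V : Type*}

lemma bdry_single {j : ℕ} (x : Fin (j + 1) → V) :
    bdry j (Finsupp.single x 1) =
      ∑ i : Fin (j + 1), Finsupp.single (x ∘ i.succAbove) ((-1 : ℤ) ^ (i : ℕ)) := by
  simp [bdry]

/-- The terms of `∂∂x` cancel in pairs: deleting the same two entries in the two possible orders
gives opposite signs. -/
lemma bdry_bdry {j : ℕ} (c : Chain V (j + 2)) : bdry j (bdry (j + 1) c) = 0 := by
  suffices h : bdry (V := V) j ∘ₗ bdry (j + 1) = 0 from LinearMap.congr_fun h c
  refine Finsupp.lhom_ext' fun x => LinearMap.ext_ring ?_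
  have key : ∀ (y : Fin (j + 1) → V) (a : ℤ),
      bdry j (Finsupp.single y a) =
        ∑ k : Fin (j + 1), Finsupp.single (y ∘ k.succAbove) (a * (-1 : ℤ) ^ (k : ℕ)) := by
    intro y a
    simp [bdry, Finset.smul_sum]
  simp only [LinearMap.comp_apply, Finsupp.lsingle_apply, bdry_single, map_sum,
    LinearMap.zero_apply]
  rw [Finset.sum_congr rfl fun i _ => key _ _, ← Fintype.sum_prod_type']
  refine Finset.sum_involution (fun p _ => (p.1.succAbove p.2, p.2.predAbove p.1)) ?_ ?_ ?_ ?_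
  · rintro ⟨i, k⟩ -
    have h1 : (x ∘ (i.succAbove k).succAbove) ∘ (k.predAbove i).succAbove =
        (x ∘ i.succAbove) ∘ k.succAbove := by
      funext l
      simp [Fin.succAbove_succAbove_succAbove_predAbove]
    simp only [h1, ← Finsupp.single_add, ← pow_add, Fin.neg_one_pow_succAbove_add_predAbove]
    simp
  · rintro ⟨i, k⟩ - - h
    exact Fin.succAbove_ne i k (congrArg Prod.fst h)
  · simp
  · rintro ⟨i, k⟩ -
    simp [Fin.succAbove_succAbove_predAbove, Fin.predAbove_predAbove_succAbove]

lemma exists_mem_support_single_of_mem_support_map {α β : Type*} (f : (α →₀ ℤ) →ₗ[ℤ] (β →₀ ℤ))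
    (c : α →₀ ℤ) {y : β} (hy : y ∈ (f c).support) :
    ∃ x ∈ c.support, y ∈ (f (Finsupp.single x 1)).support := by
  classical
  by_contra! h
  have hc : f c = ∑ x ∈ c.support, c x • f (Finsupp.single x 1) := by
    conv_lhs => rw [← Finsupp.sum_single c, Finsupp.sum, map_sum]
    refine Finset.sum_congr rfl fun x _ => ?_
    rw [← map_smul, Finsupp.smul_single, smul_eq_mul, mul_one]
  rw [hc, Finsupp.mem_support_iff, Finsupp.finsetSum_apply] at hy
  refine hy (Finset.sum_eq_zero fun x hx => ?_)
  have := h x hx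
  rw [Finsupp.notMem_support_iff] at this
  simp [this]

lemma map_eq_map_of_single {α M : Type*} [AddCommGroup M] {f g : (α →₀ ℤ) →ₗ[ℤ] M} {c : α →₀ ℤ}
    (h : ∀ x ∈ c.support, f (Finsupp.single x 1) = g (Finsupp.single x 1)) : f c = g c := by
  rw [← Finsupp.sum_single c, Finsupp.sum, map_sum, map_sum]
  refine Finset.sum_congr rfl fun x hx => ?_
  have : Finsupp.single x (c x) = c x • Finsupp.single x (1 : ℤ) := by
    rw [Finsupp.smul_single, smul_eq_mul, mul_one]
  rw [this, map_smul, map_smul, h x hx]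

lemma exists_face_of_mem_support_bdry {j : ℕ} {c : Chain V (j + 1)} {y : Fin j → V}
    (hy : y ∈ (bdry j c).support) : ∃ x ∈ c.support, ∃ i : Fin (j + 1), y = x ∘ i.succAbove := by
  classical
  obtain ⟨x, hx, hyx⟩ := exists_mem_support_single_of_mem_support_map _ _ hy
  rw [bdry_single] at hyx
  obtain ⟨i, -, hi⟩ := Finset.mem_biUnion.1 (Finsupp.support_finsetSum hyx)
  exact ⟨x, hx, i, Finset.mem_singleton.1 (Finsupp.support_single_subset hi)⟩

/-- The chain map induced by a map of vertices. -/
noncomputable abbrev chainMap {W : Type*} (f : V → W) (j : ℕ) : Chain V j →ₗ[ℤ] Chain W j :=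
  Finsupp.lmapDomain ℤ ℤ (f ∘ ·)

lemma chainMap_single {W : Type*} (f : V → W) {j : ℕ} (x : Fin j → V) (a : ℤ) :
    chainMap f j (Finsupp.single x a) = Finsupp.single (f ∘ x) a := by
  simp [chainMap, Finsupp.mapDomain_single]

lemma bdry_chainMap {W : Type*} (f : V → W) {j : ℕ} (c : Chain V (j + 1)) :
    bdry j (chainMap f (j + 1) c) = chainMap f j (bdry j c) := by
  suffices h : bdry j ∘ₗ chainMap f (j + 1) = chainMap f j ∘ₗ bdry j from LinearMap.congr_fun h c
  refine Finsupp.lhom_ext' fun x => LinearMap.ext_ring ?_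
  simp only [LinearMap.comp_apply, Finsupp.lsingle_apply, bdry_single, map_sum, chainMap_single]
  rfl

lemma exists_of_mem_support_chainMap {W : Type*} {f : V → W} {j : ℕ} {c : Chain V j}
    {y : Fin j → W} (hy : y ∈ (chainMap f j c).support) : ∃ x ∈ c.support, y = f ∘ x := by
  obtain ⟨x, hx, hyx⟩ := exists_mem_support_single_of_mem_support_map _ _ hy
  rw [chainMap_single] at hyx
  exact ⟨x, hx, Finset.mem_singleton.1 (Finsupp.support_single_subset hyx)⟩

lemma chainMap_eq_self {f : V → V} {j : ℕ} {c : Chain V j} (h : ∀ v ∈ vertexSupport c, f v = v) :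
    chainMap f j c = c := by
  refine map_eq_map_of_single (g := LinearMap.id) fun x hx => ?_
  have : f ∘ x = x := funext fun i => h _ ⟨x, hx, i, rfl⟩
  rw [chainMap_single, this, LinearMap.id_apply]

lemma chainMap_chainMap {W U : Type*} (f : V → W) (g : W → U) {j : ℕ} (c : Chain V j) :
    chainMap g j (chainMap f j c) = chainMap (g ∘ f) j c := by
  suffices h : chainMap g j ∘ₗ chainMap f j = chainMap (g ∘ f) j from LinearMap.congr_fun h c
  refine Finsupp.lhom_ext' fun x => LinearMap.ext_ring ?_
  simp only [LinearMap.comp_apply, Finsupp.lsingle_apply, chainMap_single]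
  rfl

lemma exists_of_mem_vertexSupport_chainMap {W : Type*} {f : V → W} {j : ℕ} {c : Chain V j}
    {w : W} (hw : w ∈ vertexSupport (chainMap f j c)) : ∃ v ∈ vertexSupport c, w = f v := by
  obtain ⟨y, hy, i, rfl⟩ := hw
  obtain ⟨x, hx, rfl⟩ := exists_of_mem_support_chainMap hy
  exact ⟨x i, ⟨x, hx, i, rfl⟩, rfl⟩

end Chains

/-! ### Simplices, components and path distances -/

section Simplices

variable {V : Type*} {K : PreAbstractSimplicialComplex V}

open Classical in
/-- The entries of the tuple `x` are the vertices of a simplex of `K`. Repetitions are allowed. -/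
def SpansSimplex (K : PreAbstractSimplicialComplex V) {j : ℕ} (x : Fin j → V) : Prop :=
  Finset.univ.image x ∈ K

lemma SpansSimplex.of_range_subset {j l : ℕ} {x : Fin j → V} (hx : SpansSimplex K x)
    {y : Fin (l + 1) → V} (h : Set.range y ⊆ Set.range x) : SpansSimplex K y := by
  classical
  refine (K.isRelLowerSet_faces hx).2 ?_ ⟨_, Finset.mem_image_of_mem y (Finset.mem_univ 0)⟩
  intro v hv
  obtain ⟨i, -, rfl⟩ := Finset.mem_image.1 hv
  obtain ⟨i', hi'⟩ := h ⟨i, rfl⟩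
  exact hi' ▸ Finset.mem_image_of_mem x (Finset.mem_univ i')

lemma SpansSimplex.comp {j l : ℕ} {x : Fin j → V} (hx : SpansSimplex K x)
    (a : Fin (l + 1) → Fin j) : SpansSimplex K (x ∘ a) :=
  hx.of_range_subset (Set.range_comp_subset_range a x)

lemma spansSimplex_fin_one {x : Fin 1 → V} : SpansSimplex K x ↔ {x 0} ∈ K := by
  classical
  have : Finset.univ.image x = {x 0} := by
    ext v; simp
  unfold SpansSimplex
  rw [← this]

lemma SpansSimplex.vertex_mem {j : ℕ} {x : Fin j → V} (hx : SpansSimplex K x) (i : Fin j) :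
    {x i} ∈ K :=
  spansSimplex_fin_one.1 (hx.comp fun _ : Fin 1 => i)

lemma SpansSimplex.adj_or_eq {j : ℕ} {x : Fin j → V} (hx : SpansSimplex K x) (i i' : Fin j) :
    (edgeGraph K).Adj (x i) (x i') ∨ x i = x i' := by
  classical
  by_cases h : x i = x i'
  · exact Or.inr h
  · refine Or.inl ⟨h, ?_⟩
    have := hx.comp ![i, i']
    unfold SpansSimplex at this
    convert this using 1
    ext v
    simp [Fin.exists_fin_two, eq_comm]

lemma SpansSimplex.pathDist_le_one {j : ℕ} {x : Fin j → V} (hx : SpansSimplex K x)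
    (i i' : Fin j) : pathDist K (x i) (x i') ≤ 1 :=
  SimpleGraph.edist_le_one_iff_adj_or_eq.2 (hx.adj_or_eq i i')

lemma spansSimplex_fullSubcomplex {A : Set V} {j : ℕ} {x : Fin j → V} :
    SpansSimplex (fullSubcomplex K A) x ↔ SpansSimplex K x ∧ ∀ i, x i ∈ A := by
  classical
  change (_ ∧ ∀ v ∈ Finset.univ.image x, v ∈ A) ↔ _
  simp [SpansSimplex]

lemma fullSubcomplex_le (K : PreAbstractSimplicialComplex V) (A : Set V) :
    fullSubcomplex K A ≤ K := fun _ h => h.1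

lemma isChainIn_fullSubcomplex {A : Set V} {j : ℕ} {c : Chain V j} :
    IsChainIn (fullSubcomplex K A) c ↔ IsChainIn K c ∧ ∀ v ∈ vertexSupport c, v ∈ A := by
  constructor
  · refine fun h => ⟨fun x hx => (h x hx).1, ?_⟩
    rintro v ⟨x, hx, i, rfl⟩
    exact (spansSimplex_fullSubcomplex.1 (h x hx)).2 i
  · exact fun h x hx => spansSimplex_fullSubcomplex.2 ⟨h.1 x hx, fun i => h.2 _ ⟨x, hx, i, rfl⟩⟩

lemma IsChainIn.vertex_mem {j : ℕ} {c : Chain V j} (hc : IsChainIn K c) {v : V}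
    (hv : v ∈ vertexSupport c) : {v} ∈ K := by
  obtain ⟨x, hx, i, rfl⟩ := hv
  exact SpansSimplex.vertex_mem (hc x hx) i

/-- A filling of a cycle `S` can be restricted to the connected components that meet the support
of `S`: the boundary of the rest has no vertex there. -/
lemma BoundsIn.exists_reachable {n : ℕ} {S : Chain V (n + 1)} (h : BoundsIn K S) :
    ∃ c : Chain V (n + 2), IsChainIn K c ∧ bdry (n + 1) c = S ∧
      ∀ v ∈ vertexSupport c, ∃ w ∈ vertexSupport S, (edgeGraph K).Reachable w v := by
  classical
  obtain ⟨c, hc, hcS⟩ := h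
  -- The vertices of a simplex of `K` lie either all in `U` or all outside `U`.
  set U : Set V := {v | ∃ w ∈ vertexSupport S, (edgeGraph K).Reachable w v}
  have hmem : ∀ x ∈ c.support, ∀ i i', x i ∈ U → x i' ∈ U := by
    rintro x hx i i' ⟨w, hw, hwr⟩
    refine ⟨w, hw, hwr.trans ?_⟩
    rcases SpansSimplex.adj_or_eq (hc x hx) i i' with h | h
    · exact h.reachable
    · rw [h]
  set c₁ := c.filter fun x => x 0 ∈ U with hc₁
  set c₂ := c.filter fun x => ¬ x 0 ∈ U with hc₂
  have hsum : c₁ + c₂ = c := Finsupp.filter_add_filter_not c _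
  have hs₁ : ∀ x ∈ c₁.support, x ∈ c.support ∧ x 0 ∈ U := fun x hx => by
    simpa [hc₁, Finsupp.support_filter] using hx
  have hs₂ : ∀ x ∈ c₂.support, x ∈ c.support ∧ ¬ x 0 ∈ U := fun x hx => by
    simpa [hc₂, Finsupp.support_filter] using hx
  refine ⟨c₁, fun x hx => hc x (hs₁ x hx).1, ?_, ?_⟩
  · have hb : bdry (n + 1) c₁ + bdry (n + 1) c₂ = S := by rw [← map_add, hsum, hcS]
    ext y
    have hb' := DFunLike.congr_fun hb y
    rw [Finsupp.add_apply] at hb'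
    by_cases hy : y 0 ∈ U
    · have : bdry (n + 1) c₂ y = 0 := by
        by_contra hne
        obtain ⟨x, hx, i, rfl⟩ := exists_face_of_mem_support_bdry (Finsupp.mem_support_iff.2 hne)
        exact (hs₂ x hx).2 (hmem x (hs₂ x hx).1 _ 0 hy)
      rw [this, add_zero] at hb'
      exact hb'
    · have h₁ : bdry (n + 1) c₁ y = 0 := by
        by_contra hne
        obtain ⟨x, hx, i, rfl⟩ := exists_face_of_mem_support_bdry (Finsupp.mem_support_iff.2 hne)
        exact hy (hmem x (hs₁ x hx).1 0 _ (hs₁ x hx).2)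
      have h₂ : S y = 0 := by
        by_contra hne
        exact hy ⟨y 0, ⟨y, Finsupp.mem_support_iff.2 hne, 0, rfl⟩, SimpleGraph.Reachable.refl _⟩
      rw [h₁, h₂]
  · rintro v ⟨x, hx, i, rfl⟩
    exact hmem x (hs₁ x hx).1 0 i (hs₁ x hx).2

/-- If the vertices of `L` lie in a finite set `F`, then vertices in the same component of `L` are
joined by a path in `L` of length at most `#F`, since a shortest path repeats no vertex. -/
lemma pathDist_le_card_of_reachable {L : PreAbstractSimplicialComplex V} (hLK : L ≤ K)
    (F : Finset V) (hF : ∀ v, {v} ∈ L → v ∈ F) {v w : V} (h : (edgeGraph L).Reachable v w) :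
    pathDist K v w ≤ F.card := by
  classical
  have hle : edgeGraph L ≤ edgeGraph K := by
    rintro a b ⟨hab, hmem⟩
    exact ⟨hab, hLK hmem⟩
  obtain ⟨p, hp⟩ := h.exists_isPath
  have hin : ∀ {a b : V}, (edgeGraph L).Adj a b → a ∈ F := by
    rintro a b ⟨hab, hmem⟩
    exact hF a ((L.isRelLowerSet_faces hmem).2 (by simp) (by simp))
  have hlen : p.length ≤ F.card := by
    rcases Nat.eq_zero_or_pos p.length with h0 | h0
    · omega
    have hsub : p.support.toFinset ⊆ F := by
      intro a ha
      rw [List.mem_toFinset] at ha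
      have hnil : ¬ p.Nil := fun hn => by simp [SimpleGraph.Walk.length_eq_zero_iff.2 hn] at h0
      obtain ⟨e, he, hae⟩ := (SimpleGraph.Walk.mem_support_iff_exists_mem_edges_of_not_nil hnil).1 ha
      have hadj := p.edges_subset_edgeSet he
      obtain ⟨b, rfl⟩ := hae
      exact hin hadj
    have h1 := Finset.card_le_card hsub
    rw [List.toFinset_card_of_nodup hp.support_nodup, SimpleGraph.Walk.length_support] at h1
    omega
  calc pathDist K v w ≤ (edgeGraph L).edist v w := SimpleGraph.edist_anti hle
    _ ≤ p.length := SimpleGraph.edist_le p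
    _ ≤ F.card := by exact_mod_cast hlen

/-- Connectedness in degree `0`: the cycle `v - o` bounds, so `v` and `o` lie in the same
component. -/
lemma IsHomologicallyConnected.reachable {n : ℕ} (hK : IsHomologicallyConnected n K) {o v : V}
    (ho : {o} ∈ K) (hv : {v} ∈ K) : (edgeGraph K).Reachable o v := by
  classical
  by_contra hr
  set x : Fin 1 → V := fun _ => o
  set y : Fin 1 → V := fun _ => v
  have hne : y ≠ x := fun h => hr (by
    have : v = o := congrFun h 0
    rw [this])
  have hS : IsCycleIn K (Finsupp.single y 1 - Finsupp.single x 1 : Chain V 1) := by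
    refine ⟨fun z hz => ?_, ?_⟩
    · rcases Finset.mem_union.1 (Finsupp.support_sub hz) with h | h
      · rw [Finset.mem_singleton.1 (Finsupp.support_single_subset h)]
        exact spansSimplex_fin_one.2 hv
      · rw [Finset.mem_singleton.1 (Finsupp.support_single_subset h)]
        exact spansSimplex_fin_one.2 ho
    · rw [map_sub, bdry_single, bdry_single]
      simp [Subsingleton.elim (y ∘ _) (x ∘ Fin.succAbove 0)]
  obtain ⟨c, hc, hcS⟩ := hK.2 0 (Nat.zero_le _) _ hS
  -- The total coefficient of the vertices reachable from `o` vanishes on boundaries.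
  set φ : Chain V 1 →ₗ[ℤ] ℤ := Finsupp.linearCombination ℤ fun z : Fin 1 → V =>
    if (edgeGraph K).Reachable o (z 0) then (1 : ℤ) else 0 with hφ
  have h0 : φ (bdry 1 c) = 0 := by
    refine map_eq_map_of_single (f := φ ∘ₗ bdry 1) (g := 0) fun z hz => ?_
    have hz' : (edgeGraph K).Reachable o (z 0) ↔ (edgeGraph K).Reachable o (z 1) := by
      rcases SpansSimplex.adj_or_eq (hc z hz) 0 1 with h | h
      · exact ⟨fun h' => h'.trans h.reachable, fun h' => h'.trans h.symm.reachable⟩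
      · rw [h]
    simp [LinearMap.comp_apply, bdry_single, Fin.sum_univ_two, hφ, hz']
  rw [hcS] at h0
  simp [hφ, x, y, hr] at h0

end Simplices

/-! ### Group actions: orbits, degrees and growth of balls -/

section Actions

variable {H V : Type*} [Group H] [MulAction H V] {n : ℕ} {K : PreAbstractSimplicialComplex V}

lemma SpansSimplex.smul (hinv : ∀ g : H, ∀ s ∈ K, s.map (MulAction.toPerm g).toEmbedding ∈ K)
    (g : H) {j : ℕ} {x : Fin j → V} (hx : SpansSimplex K x) :
    SpansSimplex K ((g • ·) ∘ x) := by
  classical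
  have h := hinv g _ hx
  rw [Finset.map_eq_image, Finset.image_image] at h
  unfold SpansSimplex
  convert h
  rfl

lemma singleton_smul_mem (hinv : ∀ g : H, ∀ s ∈ K, s.map (MulAction.toPerm g).toEmbedding ∈ K)
    (g : H) {v : V} (hv : {v} ∈ K) : {g • v} ∈ K := by
  simpa using hinv g _ hv

lemma IsChainIn.smul (hinv : ∀ g : H, ∀ s ∈ K, s.map (MulAction.toPerm g).toEmbedding ∈ K)
    (g : H) {j : ℕ} {c : Chain V j} (hc : IsChainIn K c) :
    IsChainIn K (chainMap (g • ·) j c) := by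
  intro y hy
  obtain ⟨x, hx, rfl⟩ := exists_of_mem_support_chainMap hy
  exact SpansSimplex.smul hinv g (hc x hx)

lemma pathDist_smul_le (hinv : ∀ g : H, ∀ s ∈ K, s.map (MulAction.toPerm g).toEmbedding ∈ K)
    (g : H) (v w : V) : pathDist K (g • v) (g • w) ≤ pathDist K v w := by
  classical
  by_cases hr : (edgeGraph K).Reachable v w
  · let φ : edgeGraph K →g edgeGraph K :=
      { toFun := (g • ·)
        map_rel' := by
          rintro a b ⟨hab, hmem⟩
          refine ⟨fun h => hab (MulAction.injective g h), ?_⟩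
          have h := hinv g _ hmem
          rw [Finset.map_eq_image] at h
          convert h using 1
          ext
          simp }
    obtain ⟨p, hp⟩ := hr.exists_walk_length_eq_edist
    unfold pathDist
    rw [← hp, ← SimpleGraph.Walk.length_map φ p]
    exact SimpleGraph.edist_le (p.map φ)
  · unfold pathDist
    rw [SimpleGraph.edist_eq_top_of_not_reachable hr]
    exact le_top

lemma IsThickening.exists_vertex_representatives (hK : IsThickening H n K) :
    ∃ U : Finset V, ∀ v, {v} ∈ K → ∃ g : H, ∃ u ∈ U, v = g • u := by
  obtain ⟨F, hF, hcov⟩ := hK.cocompact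
  have hfin : {u : V | ({u} : Finset V) ∈ F}.Finite :=
    hF.preimage (Finset.singleton_injective.injOn)
  refine ⟨hfin.toFinset, fun v hv => ?_⟩
  obtain ⟨g, t, ht, hvt⟩ := hcov _ hv
  have hcard : t.card = 1 := by rw [← Finset.card_map, ← hvt, Finset.card_singleton]
  obtain ⟨u, rfl⟩ := Finset.card_eq_one.1 hcard
  refine ⟨g, u, by simpa using ht, ?_⟩
  simpa using hvt

/-- The elements carrying `t` to `u` form a coset of the finite stabilizer of `u`. -/
lemma IsThickening.finite_smul_eq (hK : IsThickening H n K) {u : V} (hu : {u} ∈ K) (t : V) :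
    {g : H | g • t = u}.Finite := by
  rcases Set.eq_empty_or_nonempty {g : H | g • t = u} with h | ⟨g₀, hg₀⟩
  · rw [h]
    exact Set.finite_empty
  have := hK.proper u hu
  refine ((Set.toFinite (MulAction.stabilizer H u : Set H)).image (· * g₀)).subset ?_
  intro g hg
  refine ⟨g * g₀⁻¹, ?_, by simp⟩
  have h1 : g₀⁻¹ • u = t := by rw [← show g₀ • t = u from hg₀, inv_smul_smul]
  simp only [SetLike.mem_coe, MulAction.mem_stabilizer_iff, mul_smul, h1]
  exact hg

lemma IsThickening.finite_adj (hK : IsThickening H n K) {u : V} (hu : {u} ∈ K) :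
    {w | (edgeGraph K).Adj u w}.Finite := by
  classical
  obtain ⟨F, hF, hcov⟩ := hK.cocompact
  refine Set.Finite.subset (s := ⋃ t ∈ F, ⋃ a ∈ t, ⋃ g ∈ {g : H | g • a = u},
    (((t.image (g • ·) : Finset V)) : Set V)) ?_ ?_
  · exact hF.biUnion fun t _ => t.finite_toSet.biUnion fun a _ =>
      (hK.finite_smul_eq hu a).biUnion fun g _ => Finset.finite_toSet _
  · rintro w ⟨-, hmem⟩
    obtain ⟨g, t, ht, hgt⟩ := hcov _ hmem
    have h1 : u ∈ t.map (MulAction.toPerm g).toEmbedding := by rw [← hgt]; simp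
    have h2 : w ∈ t.map (MulAction.toPerm g).toEmbedding := by rw [← hgt]; simp
    obtain ⟨a, ha, hau⟩ := Finset.mem_map.1 h1
    obtain ⟨b, hb, hbw⟩ := Finset.mem_map.1 h2
    simp only [Set.mem_iUnion]
    exact ⟨t, ht, a, ha, g, hau, by simpa using ⟨b, hb, hbw⟩⟩

lemma IsThickening.exists_degree_bound (hK : IsThickening H n K) :
    ∃ d : ℕ, ∀ v, ∃ N : Finset V, N.card ≤ d ∧ ∀ w, (edgeGraph K).Adj v w → w ∈ N := by
  classical
  obtain ⟨U, hU⟩ := hK.exists_vertex_representatives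
  refine ⟨∑ u ∈ U, {w | (edgeGraph K).Adj u w}.ncard, fun v => ?_⟩
  by_cases hv : {v} ∈ K
  · obtain ⟨g, u, hu, rfl⟩ := hU v hv
    have hu' : {u} ∈ K := by simpa using singleton_smul_mem hK.invariant g⁻¹ hv
    have hfin := hK.finite_adj hu'
    refine ⟨hfin.toFinset.image (g • ·), ?_, fun w hw => ?_⟩
    · refine Finset.card_image_le.trans ?_
      rw [← Set.ncard_eq_toFinset_card _ hfin]
      exact Finset.single_le_sum (f := fun u => {w | (edgeGraph K).Adj u w}.ncard)
        (fun _ _ => Nat.zero_le _) hu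
    · refine Finset.mem_image.2 ⟨g⁻¹ • w, ?_, smul_inv_smul g w⟩
      have h1 := pathDist_smul_le hK.invariant g⁻¹ (g • u) w
      rw [inv_smul_smul] at h1
      have h2 := h1.trans (SimpleGraph.edist_le_one_iff_adj_or_eq.2 (Or.inl hw))
      rcases SimpleGraph.edist_le_one_iff_adj_or_eq.1 h2 with h | h
      · simpa using h
      · exact absurd (by rw [h, smul_inv_smul]) hw.1
  · refine ⟨∅, by simp, fun w hw => absurd ?_ hv⟩
    exact (K.isRelLowerSet_faces hw.2).2 (by simp) (by simp)

lemma exists_adj_of_edist_le_succ {G : SimpleGraph V} {v w : V} {r : ℕ}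
    (h : G.edist v w ≤ (r + 1 : ℕ)) : ∃ u, G.edist v u ≤ r ∧ (u = w ∨ G.Adj u w) := by
  have hr : G.Reachable v w := by
    rw [← SimpleGraph.edist_ne_top_iff_reachable]
    exact ne_top_of_le_ne_top (ENat.natCast_ne_top _) h
  obtain ⟨p, hp⟩ := hr.exists_walk_length_eq_edist
  rw [← hp] at h
  have h' : p.length ≤ r + 1 := by exact_mod_cast h
  by_cases h0 : p.length = 0
  · obtain rfl := SimpleGraph.Walk.eq_of_length_eq_zero h0
    exact ⟨v, by simp, Or.inl rfl⟩
  · have hnil : ¬ p.Nil := fun hn => h0 (SimpleGraph.Walk.length_eq_zero_iff.2 hn)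
    refine ⟨p.penultimate, ?_, Or.inr (p.adj_penultimate hnil)⟩
    refine (SimpleGraph.edist_le p.dropLast).trans ?_
    have := p.length_dropLast_add_one hnil
    exact_mod_cast (by omega : p.dropLast.length ≤ r)

/-- Balls grow at most exponentially, by uniform local finiteness. -/
lemma IsThickening.exists_ball_card_le (hK : IsThickening H n K) :
    ∃ M : ℕ, 1 ≤ M ∧ ∀ (v : V) (r : ℕ), ∃ F : Finset V, F.card ≤ M ^ r ∧
      ∀ w, pathDist K v w ≤ r → w ∈ F := by
  classical
  obtain ⟨d, hd⟩ := hK.exists_degree_bound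
  choose N hNcard hN using hd
  refine ⟨d + 1, by omega, fun v r => ?_⟩
  induction r with
  | zero =>
    refine ⟨{v}, by simp, fun w hw => ?_⟩
    have : (edgeGraph K).edist v w = 0 := by simpa [pathDist] using hw
    simp [SimpleGraph.edist_eq_zero_iff.1 this]
  | succ r ih =>
    obtain ⟨F, hFcard, hF⟩ := ih
    refine ⟨F.biUnion fun u => insert u (N u), ?_, fun w hw => ?_⟩
    · calc _ ≤ F.card * (d + 1) := Finset.card_biUnion_le_card_mul _ _ _ fun u _ =>
            (Finset.card_insert_le _ _).trans (Nat.succ_le_succ (hNcard u))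
        _ ≤ (d + 1) ^ r * (d + 1) := Nat.mul_le_mul_right _ hFcard
        _ = _ := (pow_succ _ _).symm
    · obtain ⟨u, hu, huw⟩ := exists_adj_of_edist_le_succ hw
      refine Finset.mem_biUnion.2 ⟨u, hF u hu, ?_⟩
      rcases huw with rfl | huw
      · exact Finset.mem_insert_self _ _
      · exact Finset.mem_insert_of_mem (hN u w huw)

lemma pathDist_anti {K' : PreAbstractSimplicialComplex V} (h : K ≤ K') (v w : V) :
    pathDist K' v w ≤ pathDist K v w :=
  SimpleGraph.edist_anti (by rintro a b ⟨hab, hmem⟩; exact ⟨hab, h hmem⟩)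

lemma IsThickening.exists_translate_near (hK : IsThickening H n K) {o : V} (ho : {o} ∈ K) :
    ∃ D : ℕ, ∀ v, {v} ∈ K → ∃ g : H, pathDist K o (g • v) ≤ D := by
  obtain ⟨U, hU⟩ := hK.exists_vertex_representatives
  refine ⟨∑ u ∈ U, (pathDist K o u).toNat, fun v hv => ?_⟩
  obtain ⟨g, u, hu, rfl⟩ := hU v hv
  have hu' : {u} ∈ K := by simpa using singleton_smul_mem hK.invariant g⁻¹ hv
  refine ⟨g⁻¹, ?_⟩
  have hfin : pathDist K o u ≠ ⊤ :=
    SimpleGraph.edist_ne_top_iff_reachable.2 (hK.connected.reachable ho hu')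
  rw [inv_smul_smul, ← ENat.natCast_toNat hfin]
  exact_mod_cast Finset.single_le_sum (f := fun u => (pathDist K o u).toNat)
    (fun _ _ => Nat.zero_le _) hu

end Actions

/-! ### Local fillings -/

section LocalFilling

variable {V : Type*}

lemma pathDist_triangle (K : PreAbstractSimplicialComplex V) {u v w : V} {a b : ℕ}
    (h₁ : pathDist K u v ≤ a) (h₂ : pathDist K v w ≤ b) : pathDist K u w ≤ (a + b : ℕ) := by
  push_cast
  exact (SimpleGraph.edist_triangle (G := edgeGraph K)).trans (add_le_add h₁ h₂)

lemma pathDist_comm (K : PreAbstractSimplicialComplex V) (u v : V) :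
    pathDist K u v = pathDist K v u := SimpleGraph.edist_comm

/-- Every cycle of `K` of degree at most `n` that lies in the `K'`-ball of radius `s` around some
vertex of `K` bounds in `K` inside the concentric `K'`-ball of radius `t`, by a chain whose
vertices are at `K`-distance at most `e` from the cycle. -/
def HasLocalFillings (n : ℕ) (K' K : PreAbstractSimplicialComplex V) (s t e : ℕ) : Prop :=
  ∀ v, {v} ∈ K → ∀ i ≤ n, ∀ S : Chain V (i + 1), IsCycleIn K S →
    (∀ w ∈ vertexSupport S, pathDist K' v w ≤ s) →
    ∃ c : Chain V (i + 2), IsChainIn K c ∧ bdry (i + 1) c = S ∧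
      (∀ w ∈ vertexSupport c, pathDist K' v w ≤ t) ∧
      ∀ w ∈ vertexSupport c, ∃ u ∈ vertexSupport S, pathDist K u w ≤ e

/-- Connected inclusions of balls around `o` yield fillings around every vertex, by cocompactness
of the action on `K`. The filling lies in components of a ball of `K'`, whose number of vertices
is exponential in the radius; this bounds its distance to the cycle inside `K`. -/
lemma exists_hasLocalFillings {G : Type*} [Group G] [MulAction G V] {Γ : Subgroup G} {n k : ℕ}
    (hnk : n ≤ k) {K' K : PreAbstractSimplicialComplex V} (hKK' : K ≤ K')
    (hK' : IsThickening G n K') (hK : IsThickening Γ n K) {o : V} (ho : {o} ∈ K) :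
    ∃ D M : ℕ, 1 ≤ M ∧ ∀ r R, IsConnectedInclusion k (ball K' K o r) (ball K' K o R) →
      ∀ s, s + D ≤ r → HasLocalFillings n K' K s (D + R) (M ^ R) := by
  classical
  obtain ⟨D, hD⟩ := hK.exists_translate_near ho
  obtain ⟨M, hM1, hM⟩ := hK'.exists_ball_card_le
  refine ⟨D, M, hM1, fun r R hconn s hsr v hv i hi S hS hSv => ?_⟩
  obtain ⟨γ, hγ⟩ := hD v hv
  have hγ' : pathDist K' o (γ • v) ≤ D := (pathDist_anti hKK' _ _).trans hγ
  have hdist : ∀ (g : Γ) (a b : V), pathDist K' (g • a) (g • b) ≤ pathDist K' a b :=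
    fun g a b => pathDist_smul_le hK'.invariant (g : G) a b
  have hcyc : IsCycleIn (ball K' K o r) (chainMap (γ • ·) (i + 1) S) := by
    refine ⟨isChainIn_fullSubcomplex.2 ⟨hS.1.smul hK.invariant γ, fun w hw => ?_⟩, ?_⟩
    · obtain ⟨u, hu, rfl⟩ := exists_of_mem_vertexSupport_chainMap hw
      refine (pathDist_triangle K' hγ' ((hdist γ v u).trans (hSv u hu))).trans ?_
      exact_mod_cast (by omega : D + s ≤ r)
    · rw [bdry_chainMap, hS.2, map_zero]
  obtain ⟨c, hc, hcS, hcr⟩ := (hconn i (hi.trans hnk) _ hcyc).exists_reachable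
  obtain ⟨hcK, hcR⟩ := isChainIn_fullSubcomplex.1 hc
  obtain ⟨F, hFcard, hF⟩ := hM o R
  have hFR : ∀ w, {w} ∈ ball K' K o R → w ∈ F := fun w hw => hF w (hw.2 w (by simp))
  refine ⟨chainMap (γ⁻¹ • ·) (i + 2) c, hcK.smul hK.invariant γ⁻¹, ?_, fun w hw => ?_,
    fun w hw => ?_⟩
  · rw [bdry_chainMap, hcS, chainMap_chainMap]
    exact chainMap_eq_self fun v _ => inv_smul_smul γ v
  · obtain ⟨u, hu, rfl⟩ := exists_of_mem_vertexSupport_chainMap hw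
    have h1 := hdist γ⁻¹ (γ • v) u
    rw [inv_smul_smul] at h1
    rw [pathDist_comm] at hγ'
    exact h1.trans (pathDist_triangle K' hγ' (hcR u hu))
  · obtain ⟨u, hu, rfl⟩ := exists_of_mem_vertexSupport_chainMap hw
    obtain ⟨y, hy, hyu⟩ := hcr u hu
    obtain ⟨z, hz, rfl⟩ := exists_of_mem_vertexSupport_chainMap hy
    refine ⟨z, hz, ?_⟩
    have h1 := pathDist_smul_le hK.invariant γ⁻¹ (γ • z) u
    rw [inv_smul_smul] at h1
    refine h1.trans ((pathDist_le_card_of_reachable (fullSubcomplex_le _ _) F hFR hyu).trans ?_)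
    exact_mod_cast hFcard

end LocalFilling

/-! ### Chain maps from the Rips complex -/

section ControlledMaps

variable {V : Type*} {K' K : PreAbstractSimplicialComplex V}

/-- The entries of the tuple `x` are vertices of `K` at pairwise `K'`-distance at most `ρ`; that is,
`x` spans a simplex of the Rips complex of `K` for the restricted metric, with parameter `ρ`. -/
def IsRipsTuple (K' K : PreAbstractSimplicialComplex V) (ρ : ℕ) {j : ℕ} (x : Fin j → V) : Prop :=
  (∀ i, {x i} ∈ K) ∧ ∀ i i', pathDist K' (x i) (x i') ≤ ρ

lemma IsRipsTuple.comp {ρ j l : ℕ} {x : Fin j → V} (hx : IsRipsTuple K' K ρ x)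
    (a : Fin l → Fin j) : IsRipsTuple K' K ρ (x ∘ a) :=
  ⟨fun i => hx.1 (a i), fun i i' => hx.2 (a i) (a i')⟩

/-- A map on `j`-chains that is the identity on `K` and replaces each Rips tuple `x` of parameter
`ρ` by a chain of `K` whose vertices are at `K'`-distance at most `a` from every entry of `x`
and at `K`-distance at most `e` from some entry of `x`. -/
structure IsControlled (K' K : PreAbstractSimplicialComplex V) (ρ a e : ℕ) {j : ℕ}
    (g : Chain V (j + 1) →ₗ[ℤ] Chain V (j + 1)) : Prop where
  map_simplex : ∀ x : Fin (j + 1) → V, SpansSimplex K x →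
    g (Finsupp.single x 1) = Finsupp.single x 1
  isChainIn : ∀ x, IsRipsTuple K' K ρ x → IsChainIn K (g (Finsupp.single x 1))
  pathDist_le : ∀ x, IsRipsTuple K' K ρ x →
    ∀ w ∈ vertexSupport (g (Finsupp.single x 1)), ∀ i, pathDist K' (x i) w ≤ a
  exists_pathDist_le : ∀ x, IsRipsTuple K' K ρ x →
    ∀ w ∈ vertexSupport (g (Finsupp.single x 1)), ∃ i, pathDist K (x i) w ≤ e

lemma exists_of_mem_vertexSupport_single {j : ℕ} {x : Fin j → V} {w : V}
    (hw : w ∈ vertexSupport (Finsupp.single x 1 : Chain V j)) : ∃ i, w = x i := by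
  obtain ⟨y, hy, i, rfl⟩ := hw
  rw [Finset.mem_singleton.1 (Finsupp.support_single_subset hy)]
  exact ⟨i, rfl⟩

lemma isControlled_id (ρ e : ℕ) :
    IsControlled K' K ρ 0 e (LinearMap.id : Chain V 1 →ₗ[ℤ] Chain V 1) where
  map_simplex _ _ := rfl
  isChainIn x hx y hy := by
    rw [Finset.mem_singleton.1 (Finsupp.support_single_subset hy)]
    exact spansSimplex_fin_one.2 (hx.1 0)
  pathDist_le x _ w hw i := by
    obtain ⟨i', rfl⟩ := exists_of_mem_vertexSupport_single hw
    have : i = i' := Subsingleton.elim (α := Fin 1) i i'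
    simp [pathDist, this]
  exists_pathDist_le x _ w hw := by
    obtain ⟨i, rfl⟩ := exists_of_mem_vertexSupport_single hw
    exact ⟨i, by simp [pathDist]⟩

lemma IsControlled.map_eq_self {ρ a e j : ℕ} {g : Chain V (j + 1) →ₗ[ℤ] Chain V (j + 1)}
    (hg : IsControlled K' K ρ a e g) {S : Chain V (j + 1)} (hS : IsChainIn K S) : g S = S :=
  map_eq_map_of_single (g := LinearMap.id) fun x hx => hg.map_simplex x (hS x hx)

/-- One step of the construction of the chain map from the Rips complex to `K`: each Rips tuple is
sent to a local filling of the image of its boundary. -/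
lemma IsControlled.exists_extension {n j ρ a e t e' : ℕ} (hj : j ≤ n)
    (hfill : HasLocalFillings n K' K (ρ + a) t e')
    {g : Chain V (j + 1) →ₗ[ℤ] Chain V (j + 1)} (hg : IsControlled K' K ρ a e g)
    (hcyc : ∀ x : Fin (j + 2) → V, IsRipsTuple K' K ρ x →
      bdry j (g (bdry (j + 1) (Finsupp.single x 1))) = 0) :
    ∃ g' : Chain V (j + 2) →ₗ[ℤ] Chain V (j + 2), IsControlled K' K ρ (ρ + t) (e + e') g' ∧
      ∀ x : Fin (j + 2) → V, IsRipsTuple K' K ρ x →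
        bdry (j + 1) (g' (Finsupp.single x 1)) = g (bdry (j + 1) (Finsupp.single x 1)) := by
  classical
  have key : ∀ x : Fin (j + 2) → V, ∃ c : Chain V (j + 2),
      (SpansSimplex K x → c = Finsupp.single x 1) ∧ (IsRipsTuple K' K ρ x →
        bdry (j + 1) c = g (bdry (j + 1) (Finsupp.single x 1)) ∧ IsChainIn K c ∧
        (∀ w ∈ vertexSupport c, ∀ i, pathDist K' (x i) w ≤ (ρ + t : ℕ)) ∧
        ∀ w ∈ vertexSupport c, ∃ i, pathDist K (x i) w ≤ (e + e' : ℕ)) := by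
    intro x
    by_cases hs : SpansSimplex K x
    · refine ⟨Finsupp.single x 1, fun _ => rfl, fun hx => ⟨?_, ?_, ?_, ?_⟩⟩
      · refine (hg.map_eq_self fun y hy => ?_).symm
        obtain ⟨z, hz, i, rfl⟩ := exists_face_of_mem_support_bdry hy
        rw [Finset.mem_singleton.1 (Finsupp.support_single_subset hz)]
        exact hs.comp _
      · intro y hy
        rw [Finset.mem_singleton.1 (Finsupp.support_single_subset hy)]
        exact hs
      · intro w hw i
        obtain ⟨i', rfl⟩ := exists_of_mem_vertexSupport_single hw
        exact (hx.2 i i').trans (by exact_mod_cast Nat.le_add_right _ _)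
      · intro w hw
        obtain ⟨i, rfl⟩ := exists_of_mem_vertexSupport_single hw
        exact ⟨i, by simp [pathDist]⟩
    · by_cases hx : IsRipsTuple K' K ρ x
      swap
      · exact ⟨0, fun h => absurd h hs, fun h => absurd h hx⟩
      set S := g (bdry (j + 1) (Finsupp.single x 1))
      -- The simplices of `g ∂x` come from faces of `x`, so `g` controls them.
      have hface : ∀ y ∈ S.support, ∃ i : Fin (j + 2),
          y ∈ (g (Finsupp.single (x ∘ i.succAbove) 1)).support := by
        intro y hy
        obtain ⟨z, hz, hyz⟩ := exists_mem_support_single_of_mem_support_map g _ hy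
        obtain ⟨z', hz', i, rfl⟩ := exists_face_of_mem_support_bdry hz
        rw [Finset.mem_singleton.1 (Finsupp.support_single_subset hz')] at hyz
        exact ⟨i, hyz⟩
      have hS_cycle : IsCycleIn K S := by
        refine ⟨fun y hy => ?_, hcyc x hx⟩
        obtain ⟨i, hi⟩ := hface y hy
        exact hg.isChainIn _ (hx.comp _) y hi
      have hS_near : ∀ w ∈ vertexSupport S, pathDist K' (x 0) w ≤ (ρ + a : ℕ) := by
        rintro w ⟨y, hy, l, rfl⟩
        obtain ⟨i, hi⟩ := hface y hy
        exact pathDist_triangle K' (hx.2 0 _)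
          (hg.pathDist_le _ (hx.comp i.succAbove) _ ⟨y, hi, l, rfl⟩ 0)
      obtain ⟨c, hc, hcS, hct, hce⟩ := hfill (x 0) (hx.1 0) j hj S hS_cycle hS_near
      refine ⟨c, fun h => absurd h hs, fun _ => ⟨hcS, hc, fun w hw i => ?_, fun w hw => ?_⟩⟩
      · exact pathDist_triangle K' (hx.2 i 0) (hct w hw)
      · obtain ⟨u, ⟨y, hy, l, rfl⟩, hu⟩ := hce w hw
        obtain ⟨i, hi⟩ := hface y hy
        obtain ⟨i', hi'⟩ := hg.exists_pathDist_le _ (hx.comp i.succAbove) _ ⟨y, hi, l, rfl⟩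
        exact ⟨i.succAbove i', pathDist_triangle K hi' hu⟩
  choose φ hφ₁ hφ₂ using key
  have hsingle : ∀ x, Finsupp.linearCombination ℤ φ (Finsupp.single x 1) = φ x := by simp
  refine ⟨Finsupp.linearCombination ℤ φ, ⟨?_, ?_, ?_, ?_⟩, ?_⟩
  · intro x hx
    rw [hsingle, hφ₁ x hx]
  · intro x hx
    rw [hsingle]
    exact (hφ₂ x hx).2.1
  · intro x hx
    rw [hsingle]
    exact (hφ₂ x hx).2.2.1
  · intro x hx
    rw [hsingle]
    exact (hφ₂ x hx).2.2.2
  · intro x hx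
    rw [hsingle]
    exact (hφ₂ x hx).1

/-- If fillings are local at linear scale, then so are the maps replacing Rips tuples by chains of
`K`, in every degree up to `n`: the constants grow with the degree, but not with the scale. -/
lemma exists_isControlled {n A M ρ₀ : ℕ}
    (hfill : ∀ ρ, ρ₀ ≤ ρ → HasLocalFillings n K' K ρ (A * ρ) (M ^ ρ)) :
    ∀ j ≤ n, ∃ B N : ℕ, ∀ ρ, ρ₀ ≤ ρ → 1 ≤ ρ → ∃ g : Chain V (j + 1) →ₗ[ℤ] Chain V (j + 1),
      IsControlled K' K ρ (B * ρ) (N ^ ρ) g ∧ ∀ x : Fin (j + 2) → V, IsRipsTuple K' K ρ x →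
        bdry j (g (bdry (j + 1) (Finsupp.single x 1))) = 0 := by
  intro j
  induction j with
  | zero =>
    intro _
    refine ⟨0, 0, fun ρ _ _ => ⟨LinearMap.id, ?_, fun x _ => bdry_bdry _⟩⟩
    rw [zero_mul]
    exact isControlled_id _ _
  | succ j ih =>
    intro hj
    obtain ⟨B, N, h⟩ := ih (by omega)
    refine ⟨1 + A * (1 + B), N + M ^ (1 + B), fun ρ hρ₀ hρ => ?_⟩
    obtain ⟨g, hg, hcyc⟩ := h ρ hρ₀ hρ
    have hscale : ρ + B * ρ = (1 + B) * ρ := by ring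
    have hf := hfill ((1 + B) * ρ) (hρ₀.trans (by nlinarith [Nat.zero_le (B * ρ)]))
    rw [← hscale] at hf
    obtain ⟨g', hg', hbd⟩ := hg.exists_extension (by omega) hf hcyc
    refine ⟨g', ⟨hg'.map_simplex, hg'.isChainIn, fun x hx w hw i => ?_, fun x hx w hw => ?_⟩,
      fun x hx => ?_⟩
    · refine (hg'.pathDist_le x hx w hw i).trans ?_
      exact_mod_cast le_of_eq (by ring)
    · obtain ⟨i, hi⟩ := hg'.exists_pathDist_le x hx w hw
      refine ⟨i, hi.trans ?_⟩
      rw [hscale, pow_mul]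
      exact_mod_cast pow_add_pow_le (Nat.zero_le _) (Nat.zero_le _) (by omega : ρ ≠ 0)
    · have hface : bdry (j + 1) (g' (bdry (j + 2) (Finsupp.single x 1))) =
          g (bdry (j + 1) (bdry (j + 2) (Finsupp.single x 1))) := by
        refine map_eq_map_of_single (f := bdry (j + 1) ∘ₗ g') (g := g ∘ₗ bdry (j + 1))
          fun y hy => ?_
        obtain ⟨z, hz, i, rfl⟩ := exists_face_of_mem_support_bdry hy
        rw [Finset.mem_singleton.1 (Finsupp.support_single_subset hz)]
        exact hbd _ (hx.comp _)
      rw [hface, bdry_bdry, map_zero]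

/-- A filling of `S` in its `m`-neighbourhood in `K'` is pushed to `K`: first its vertices are moved
to nearest vertices of `S`, giving a Rips chain of parameter `2m + 1`, then this chain is mapped to
`K` by a controlled map. Both steps fix `S`, whatever its diameter. -/
lemma exists_boundsIn_nbhd {n A M ρ₀ : ℕ}
    (hfill : ∀ ρ, ρ₀ ≤ ρ → HasLocalFillings n K' K ρ (A * ρ) (M ^ ρ)) :
    ∃ N : ℕ, ∀ m, ρ₀ ≤ m → ∀ S : Chain V (n + 1), IsCycleIn K S → BoundsIn (nbhd K' S m) S →
      BoundsIn (nbhd K S (N ^ (2 * m + 1))) S := by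
  classical
  obtain ⟨B, N, h⟩ := exists_isControlled hfill n le_rfl
  refine ⟨N + M ^ (1 + B), fun m hm S hS hSm => ?_⟩
  obtain ⟨g, hg, hcyc⟩ := h (2 * m + 1) (by omega) (by omega)
  have hscale : (2 * m + 1) + B * (2 * m + 1) = (1 + B) * (2 * m + 1) := by ring
  have hf := hfill ((1 + B) * (2 * m + 1)) (by nlinarith [Nat.zero_le (B * (2 * m + 1))])
  rw [← hscale] at hf
  obtain ⟨g', hg', hbd⟩ := hg.exists_extension le_rfl hf hcyc
  obtain ⟨c, hc, hcS⟩ := hSm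
  obtain ⟨hcK, hcm⟩ := isChainIn_fullSubcomplex.1 hc
  -- The retraction of the vertices of `c` to those of `S`.
  have hproj : ∀ v, ∃ w, (v ∈ vertexSupport S → w = v) ∧
      (v ∈ vertexSupport c → w ∈ vertexSupport S ∧ pathDist K' w v ≤ m) := by
    intro v
    by_cases hvS : v ∈ vertexSupport S
    · exact ⟨v, fun _ => rfl, fun _ => ⟨hvS, by simp [pathDist]⟩⟩
    · by_cases hvc : v ∈ vertexSupport c
      · obtain ⟨w, hw, hwv⟩ := hcm v hvc
        exact ⟨w, fun h => absurd h hvS, fun _ => ⟨hw, hwv⟩⟩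
      · exact ⟨v, fun _ => rfl, fun h => absurd h hvc⟩
  choose p hp₁ hp₂ using hproj
  have hrips : ∀ x ∈ c.support, IsRipsTuple K' K (2 * m + 1) (p ∘ x) := by
    intro x hx
    have hmem : ∀ i, x i ∈ vertexSupport c := fun i => ⟨x, hx, i, rfl⟩
    refine ⟨fun i => hS.1.vertex_mem (hp₂ _ (hmem i)).1, fun i i' => ?_⟩
    have h1 := (hp₂ _ (hmem i)).2
    have h2 := (hp₂ _ (hmem i')).2
    rw [pathDist_comm] at h2
    have h3 : pathDist K' (x i) (x i') ≤ (1 : ℕ) := by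
      exact_mod_cast SpansSimplex.pathDist_le_one (hcK x hx) i i'
    refine (pathDist_triangle K' (pathDist_triangle K' h1 h3) h2).trans ?_
    exact_mod_cast le_of_eq (by ring)
  have hsupp : ∀ y ∈ (g' (chainMap p (n + 2) c)).support, ∃ x ∈ c.support,
      y ∈ (g' (Finsupp.single (p ∘ x) 1)).support := by
    intro y hy
    obtain ⟨z, hz, hyz⟩ := exists_mem_support_single_of_mem_support_map g' _ hy
    obtain ⟨x, hx, rfl⟩ := exists_of_mem_support_chainMap hz
    exact ⟨x, hx, hyz⟩
  refine ⟨g' (chainMap p (n + 2) c), isChainIn_fullSubcomplex.2 ⟨fun y hy => ?_, ?_⟩, ?_⟩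
  · obtain ⟨x, hx, hyx⟩ := hsupp y hy
    exact hg'.isChainIn _ (hrips x hx) y hyx
  · rintro w ⟨y, hy, l, rfl⟩
    obtain ⟨x, hx, hyx⟩ := hsupp y hy
    obtain ⟨i, hi⟩ := hg'.exists_pathDist_le _ (hrips x hx) _ ⟨y, hyx, l, rfl⟩
    refine ⟨p (x i), (hp₂ _ ⟨x, hx, i, rfl⟩).1, hi.trans ?_⟩
    rw [hscale, pow_mul]
    exact_mod_cast pow_add_pow_le (Nat.zero_le _) (Nat.zero_le _) (by omega : 2 * m + 1 ≠ 0)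
  · calc bdry (n + 1) (g' (chainMap p (n + 2) c))
        = g (bdry (n + 1) (chainMap p (n + 2) c)) := by
          refine map_eq_map_of_single (f := bdry (n + 1) ∘ₗ g') (g := g ∘ₗ bdry (n + 1))
            fun y hy => ?_
          obtain ⟨x, hx, rfl⟩ := exists_of_mem_support_chainMap hy
          exact hbd _ (hrips x hx)
      _ = g S := by
          rw [bdry_chainMap, hcS, chainMap_eq_self fun v hv => hp₁ v hv]
      _ = S := hg.map_eq_self hS.1

end ControlledMaps

/-! ### Bounds on the distortion -/

section Scales

variable {V : Type*} {K' K : PreAbstractSimplicialComplex V}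

/-- The infimum defining the filling radius is attained, and fillings in smaller neighbourhoods are
fillings in larger ones. -/
lemma boundsIn_nbhd_of_fillRad_le {n m : ℕ} {S : Chain V (n + 1)} (h : fillRad K S ≤ m) :
    BoundsIn (nbhd K S m) S := by
  have h' : fillRad K S < (m + 1 : ℕ) := h.trans_lt (by exact_mod_cast Nat.lt_succ_self m)
  unfold fillRad at h'
  simp only [iInf_lt_iff] at h'
  obtain ⟨R, ⟨c, hc, hcS⟩, hR⟩ := h'
  have hRm : R ≤ m := Nat.lt_succ_iff.1 (by exact_mod_cast hR)
  obtain ⟨hcK, hcR⟩ := isChainIn_fullSubcomplex.1 hc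
  refine ⟨c, isChainIn_fullSubcomplex.2 ⟨hcK, fun v hv => ?_⟩, hcS⟩
  obtain ⟨w, hw, hwv⟩ := hcR v hv
  exact ⟨w, hw, hwv.trans (by exact_mod_cast hRm)⟩

lemma exists_isConnectedInclusion_of_ballConnectivity_le {k r : ℕ} {o : V} {C : ℝ}
    (h : (ballConnectivity k K' K o r : ℝ≥0∞) ≤ ENNReal.ofReal (C * r)) :
    ∃ R ≤ ⌈C⌉₊ * r, IsConnectedInclusion k (ball K' K o r) (ball K' K o R) := by
  have h1 : (ballConnectivity k K' K o r : ℝ≥0∞) ≤ ((⌈C⌉₊ * r : ℕ) : ℕ∞) := by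
    refine h.trans ?_
    rw [ENat.toENNReal_coe, ← ENNReal.ofReal_natCast]
    refine ENNReal.ofReal_le_ofReal ?_
    push_cast
    exact mul_le_mul_of_nonneg_right (Nat.le_ceil C) (Nat.cast_nonneg r)
  have h2 : ballConnectivity k K' K o r < ((⌈C⌉₊ * r + 1 : ℕ) : ℕ∞) :=
    (ENat.toENNReal_le.1 h1).trans_lt (by exact_mod_cast Nat.lt_succ_self _)
  unfold ballConnectivity at h2
  simp only [iInf_lt_iff] at h2
  obtain ⟨R, ⟨-, hconn⟩, hR⟩ := h2
  exact ⟨R, Nat.lt_succ_iff.1 (by exact_mod_cast hR), hconn⟩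

lemma disto_le {n m N : ℕ} {𝒮 : Set (Chain V (n + 1))}
    (h : ∀ S ∈ 𝒮, fillRad K' S ≤ m → BoundsIn (nbhd K S N) S) : disto K' K 𝒮 m ≤ N :=
  iSup₂_le fun S hS => iInf₂_le N (h S hS.1 hS.2)

lemma toENNReal_le_ofReal_exp {d : ℕ∞} {M E m : ℕ} (hM : 1 ≤ M) (h : d ≤ (M ^ (E * m) : ℕ)) :
    (d : ℝ≥0∞) ≤ ENNReal.ofReal (Real.exp (E * Real.log M * m)) := by
  have hpos : (0 : ℝ) < M := by exact_mod_cast hM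
  have hexp : Real.exp (E * Real.log M * m) = ((M ^ (E * m) : ℕ) : ℝ) := by
    rw [show (E * Real.log M * m : ℝ) = (E * m : ℕ) * Real.log M by push_cast; ring,
      Real.exp_nat_mul, Real.exp_log hpos]
    push_cast
    rfl
  rw [hexp, ENNReal.ofReal_natCast, ← ENat.toENNReal_coe]
  exact ENat.toENNReal_le.2 h

/-- If all large balls are connected at linear scale, the distortion is at most exponential. -/
lemma eventually_disto_le_exp {G : Type*} [Group G] [MulAction G V] {Γ : Subgroup G} {n k : ℕ}
    (hnk : n ≤ k) (hKK' : K ≤ K') (hK' : IsThickening G n K') (hK : IsThickening Γ n K) {o : V}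
    (ho : {o} ∈ K) {𝒮 : Set (Chain V (n + 1))} (h𝒮 : ∀ S ∈ 𝒮, IsCycleIn K S) {C : ℝ}
    (hC : ∀ᶠ m : ℕ in atTop, (ballConnectivity k K' K o m : ℝ≥0∞) ≤ ENNReal.ofReal (C * m)) :
    ∃ C' : ℝ, ∀ᶠ m : ℕ in atTop,
      (disto K' K 𝒮 m : ℝ≥0∞) ≤ ENNReal.ofReal (Real.exp (C' * m)) := by
  obtain ⟨D, M, hM, hfill⟩ := exists_hasLocalFillings hnk hKK' hK' hK ho
  obtain ⟨m₀, hm₀⟩ := eventually_atTop.1 hC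
  set A := ⌈C⌉₊
  have hlin : ∀ ρ, m₀ + 1 ≤ ρ →
      HasLocalFillings n K' K ρ ((D + A * (1 + D)) * ρ) ((M ^ (A * (1 + D))) ^ ρ) := by
    intro ρ hρ
    obtain ⟨R, hR, hconn⟩ :=
      exists_isConnectedInclusion_of_ballConnectivity_le (hm₀ (ρ + D) (by omega))
    have hR' : R ≤ A * (1 + D) * ρ :=
      calc R ≤ A * (ρ + D) := hR
        _ ≤ A * ((1 + D) * ρ) := Nat.mul_le_mul_left _ (by nlinarith)
        _ = _ := by ring
    intro v hv i hi S hS hSv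
    obtain ⟨c, hc, hcS, hct, hce⟩ := hfill _ R hconn ρ le_rfl v hv i hi S hS hSv
    refine ⟨c, hc, hcS, fun w hw => (hct w hw).trans ?_, fun w hw => ?_⟩
    · exact_mod_cast (by nlinarith : D + R ≤ (D + A * (1 + D)) * ρ)
    · obtain ⟨u, hu, huw⟩ := hce w hw
      refine ⟨u, hu, huw.trans ?_⟩
      rw [← pow_mul]
      exact_mod_cast Nat.pow_le_pow_right hM hR'
  obtain ⟨N, hN⟩ := exists_boundsIn_nbhd (n := n) hlin
  refine ⟨(3 : ℕ) * Real.log (N + 1 : ℕ), ?_⟩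
  filter_upwards [eventually_ge_atTop (m₀ + 1)] with m hm
  refine toENNReal_le_ofReal_exp (by omega) ((disto_le fun S hS hSm => hN m hm S (h𝒮 S hS)
    (boundsIn_nbhd_of_fillRad_le hSm)).trans ?_)
  -- The base is `N + 1` because `N` may be `0`, and `2 * m + 1 ≤ 3 * m` as `1 ≤ m`.
  have h1 : N ^ (2 * m + 1) ≤ (N + 1) ^ (3 * m) :=
    (Nat.pow_le_pow_left (Nat.le_succ N) _).trans
      (Nat.pow_le_pow_right (Nat.succ_pos N) (by omega))
  exact_mod_cast h1

/-- For cycles of linearly bounded diameter, connectedness of a single ball at scale `r` suffices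
to bound the distortion at a scale `m` comparable with `r`. -/
lemma eventually_exists_disto_le_exp {G : Type*} [Group G] [MulAction G V] {Γ : Subgroup G}
    {n k : ℕ} (hnk : n ≤ k) (hKK' : K ≤ K') (hK' : IsThickening G n K') (hK : IsThickening Γ n K)
    {o : V} (ho : {o} ∈ K) {𝒮 : Set (Chain V (n + 1))} (h𝒮 : ∀ S ∈ 𝒮, IsCycleIn K S) {L : ℕ}
    (hL : ∀ S ∈ 𝒮, ∀ v ∈ vertexSupport S, ∀ w ∈ vertexSupport S,
      pathDist K' v w ≤ L * (fillRad K' S + 1)) (C : ℝ) :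
    ∃ C' : ℝ, ∀ m₁ : ℕ, ∀ᶠ r : ℕ in atTop,
      (ballConnectivity k K' K o r : ℝ≥0∞) ≤ ENNReal.ofReal (C * r) →
      ∃ m ≥ m₁, (disto K' K 𝒮 m : ℝ≥0∞) ≤ ENNReal.ofReal (Real.exp (C' * m)) := by
  obtain ⟨D, M, hM, hfill⟩ := exists_hasLocalFillings hnk hKK' hK' hK ho
  refine ⟨(⌈C⌉₊ * (D + 3 * (L + 1)) : ℕ) * Real.log M, fun m₁ => ?_⟩
  filter_upwards [eventually_ge_atTop (D + (L + 1) * (m₁ + 2))] with r hr hrC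
  obtain ⟨R, hR, hconn⟩ := exists_isConnectedInclusion_of_ballConnectivity_le hrC
  -- Take `m + 1 = (r - D) / (L + 1)`; the denominator is `L + 1` because `L` may be `0`.
  obtain ⟨m, hm₁, hm, hmr, hrm⟩ : ∃ m, m₁ ≤ m ∧ 1 ≤ m ∧ L * (m + 1) + D ≤ r ∧
      r ≤ (D + 3 * (L + 1)) * m := by
    have hpos : 0 < L + 1 := Nat.succ_pos L
    have hq : m₁ + 2 ≤ (r - D) / (L + 1) :=
      (Nat.le_div_iff_mul_le hpos).2 (by rw [mul_comm]; omega)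
    obtain ⟨m, hm⟩ : ∃ m, (r - D) / (L + 1) = m + 1 := Nat.exists_eq_add_of_le' (by omega)
    have h1 := Nat.div_mul_le_self (r - D) (L + 1)
    have h2 := Nat.lt_div_mul_add (a := r - D) hpos
    have h3 : D ≤ r := le_trans (Nat.le_add_right _ _) hr
    rw [hm] at h1 h2 hq
    obtain ⟨s, rfl⟩ := Nat.exists_eq_add_of_le h3
    rw [Nat.add_sub_cancel_left] at h1 h2
    exact ⟨m, by omega, by omega, by nlinarith, by nlinarith [Nat.zero_le (D * (m - 1))]⟩
  refine ⟨m, hm₁, toENNReal_le_ofReal_exp hM ((disto_le (N := M ^ R) fun S hS hSm => ?_).trans ?_)⟩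
  · obtain ⟨v, hv, hSv⟩ : ∃ v, {v} ∈ K ∧
        ∀ w ∈ vertexSupport S, pathDist K' v w ≤ (L * (m + 1) : ℕ) := by
      -- The zero cycle has no vertex; any centre will do.
      rcases Set.eq_empty_or_nonempty (vertexSupport S) with h | ⟨v, hv⟩
      · exact ⟨o, ho, by simp [h]⟩
      · refine ⟨v, (h𝒮 S hS).1.vertex_mem hv, fun w hw => (hL S hS v hv w hw).trans ?_⟩
        push_cast
        gcongr
    obtain ⟨c, hc, hcS, -, hce⟩ := hfill r R hconn _ hmr v hv n le_rfl S (h𝒮 S hS) hSv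
    exact ⟨c, isChainIn_fullSubcomplex.2 ⟨hc, hce⟩, hcS⟩
  · have h1 : M ^ R ≤ M ^ (⌈C⌉₊ * (D + 3 * (L + 1)) * m) := by
      refine Nat.pow_le_pow_right hM (hR.trans ?_)
      rw [mul_assoc]
      exact Nat.mul_le_mul_left _ hrm
    exact_mod_cast h1

end Scales

end FillingDistortion

theorem mainTheorem3 {G V : Type*} [Group G] [MulAction G V] (Γ : Subgroup G)
    (n k : ℕ) (hnk : n ≤ k) (K' K : PreAbstractSimplicialComplex V) (hKK' : K ≤ K')
    (hK' : FillingDistortion.IsThickening G n K')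
    (hK : FillingDistortion.IsThickening Γ n K)
    (o : V) (ho : {o} ∈ K)
    (𝒮 : Set (FillingDistortion.Chain V (n + 1)))
    (h𝒮 : ∀ S ∈ 𝒮, FillingDistortion.IsCycleIn K S) :
    ((∀ C : ℝ, ∃ᶠ m : ℕ in atTop,
        ENNReal.ofReal (Real.exp (C * m)) < (FillingDistortion.disto K' K 𝒮 m : ℝ≥0∞)) →
      ∀ C : ℝ, ∃ᶠ m : ℕ in atTop,
        ENNReal.ofReal (C * m) < (FillingDistortion.ballConnectivity k K' K o m : ℝ≥0∞)) ∧
    ((∃ L : ℕ, ∀ S ∈ 𝒮, ∀ v ∈ FillingDistortion.vertexSupport S,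
        ∀ w ∈ FillingDistortion.vertexSupport S,
          FillingDistortion.pathDist K' v w ≤ L * (FillingDistortion.fillRad K' S + 1)) →
      (∀ C : ℝ, ∀ᶠ m : ℕ in atTop,
        ENNReal.ofReal (Real.exp (C * m)) < (FillingDistortion.disto K' K 𝒮 m : ℝ≥0∞)) →
      ∀ C : ℝ, ∀ᶠ m : ℕ in atTop,
        ENNReal.ofReal (C * m) < (FillingDistortion.ballConnectivity k K' K o m : ℝ≥0∞)) := by
  open FillingDistortion in
  refine ⟨fun hdisto C => ?_, fun ⟨L, hL⟩ hdisto C => ?_⟩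
  · by_contra hC
    rw [not_frequently] at hC
    obtain ⟨C', hC'⟩ := eventually_disto_le_exp hnk hKK' hK' hK ho h𝒮
      (hC.mono fun m hm => not_lt.1 hm)
    exact hdisto C' (hC'.mono fun m hm => not_lt.2 hm)
  · obtain ⟨C', hC'⟩ := eventually_exists_disto_le_exp (k := k) hnk hKK' hK' hK ho h𝒮 hL C
    obtain ⟨m₁, hm₁⟩ := eventually_atTop.1 (hdisto C')
    filter_upwards [hC' m₁] with r hr
    by_contra hlt
    obtain ⟨m, hm, hle⟩ := hr (not_lt.1 hlt)
    exact absurd hle (not_le.2 (hm₁ m hm))
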